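/- Let $n,m\ge 1$ be integers and $T>0$. Put $K_k=\dfrac{(2^{k+1}-1)\,|B_{k+1}|}{2^{k-1}(k+1)!}$ for odd $k$ and $K_k=\dfrac{|E_k|}{4^k k!}$ for even $k$, where $B_k$ are the Bernoulli numbers and $E_k$ the Euler numbers, $\frac{2}{e^t+e^{-t}}=\sum_{k\ge0}E_k\frac{t^k}{k!}$. Let $F$ be an operator (not assumed linear or continuous) from the space $C([0,T],\mathbb R^m)$ of continuous functions into the space $L_1([0,T],\mathbb R^m)$ of integrable functions, and suppose that there are positive functions $p_1,\dots,p_m\in L_1([0,T],\mathbb R)$ such that for every $x\in C([0,T],\mathbb R^m)$ $$\max_{1\le i\le m}\left(\operatorname*{ess\,sup}_{t\in[0,T]}\frac{(Fx)_i(t)}{p_i(t)}-\operatorname*{ess\,inf}_{t\in[0,T]}\frac{(Fx)_i(t)}{p_i(t)}\right)\le\max_{1\le i\le m}\left(\max_{t\in[0,T]}x_i(t)-\min_{t\in[0,T]}x_i(t)\right).$$ Suppose that the periodic problem $$x^{(n)}(t)=(Fx)(t)\ \text{ for almost all } t\in[0,T],\qquad x^{(k)}(0)=x^{(k)}(T),\quad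 k=0,\dots,n-1,$$ has a non-constant solution $x$, that is, a solution $x:[0,T]\to\mathbb R^m$ whose derivatives up to order $n-1$ exist and are absolutely continuous. Then, for each index $i$ for which $\max_{[0,T]} x_i-\min_{[0,T]} x_i$ is the largest among the components of $x$, $$\|p_i\|_{L_1}\ge 4\ \text{ if } n=1,\qquad \|p_i\|_{L_1}>\frac{4}{K_{n-1}T^{n-1}}\ \text{ if } n\ge 2,$$ where $\|p_i\|_{L_1}=\int_0^T|p_i(t)|\,dt$. In particular, $\max_{1\le i\le m}\|p_i\|_{L_1}\ge 4$ if $n=1$, and $\max_{1\le i\le m}\|p_i\|_{L_1}>\dfrac{4}{K_{n-1}T^{n-1}}$ if $n\ge2$. -/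

import Mathlib

open MeasureTheory Set

noncomputable section

namespace PeriodicFDE

/-- The Euler number `E_n`: `2 / (exp t + exp (-t)) = ∑ E_n t ^ n / n!`. -/
def eulerNumber (n : ℕ) : ℚ :=
  (n.factorial : ℚ) * PowerSeries.coeff n
    (2 * (PowerSeries.exp ℚ + PowerSeries.evalNegHom (PowerSeries.exp ℚ))⁻¹)

/-- The Favard constants `K_n` (on a period of length one). -/
def favard (n : ℕ) : ℚ :=
  if Odd n then
    (2 ^ (n + 1) - 1) * |bernoulli (n + 1)| / (2 ^ (n - 1) * ((n + 1).factorial : ℚ))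
  else
    |eulerNumber n| / (4 ^ n * (n.factorial : ℚ))

/-- Lebesgue measure on `[0, T]`. -/
abbrev leb (T : ℝ) : Measure ℝ := volume.restrict (Icc 0 T)

/-- `C([0, T], ℝ^m)`. -/
abbrev Cont (T : ℝ) (m : ℕ) : Type := C(Icc (0 : ℝ) T, Fin m → ℝ)

/-- `L_1([0, T], ℝ^m)`, as a space of classes modulo equality almost everywhere. -/
abbrev LOne (T : ℝ) (m : ℕ) : Type := Lp (Fin m → ℝ) 1 (leb T)

variable {T : ℝ} {m : ℕ}

/-- `max x_i - min x_i` over `[0, T]`. -/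
def osc (x : Cont T m) (i : Fin m) : ℝ := (⨆ t, x t i) - ⨅ t, x t i

/-- Essential supremum minus essential infimum over `[0, T]`, as an extended real
(it is `⊤` when `f` is not essentially bounded). -/
def essOsc (T : ℝ) (f : ℝ → ℝ) : EReal :=
  essSup (fun t => (f t : EReal)) (leb T) - essInf (fun t => (f t : EReal)) (leb T)

/-- The weighted oscillation condition for the operator `F` and the weights `p_i`. -/
def OscCondition (F : Cont T m → LOne T m) (p : Fin m → ℝ → ℝ) : Prop :=
  ∀ x : Cont T m,
    (⨆ i, essOsc T fun t => (F x : ℝ → Fin m → ℝ) t i / p i t) ≤ ((⨆ i, osc x i : ℝ) : EReal)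

/-- The `i`-th component of `x`, as a function on `ℝ` (constant outside `[0, T]`; only its values
on `[0, T]` are used below). -/
def comp (hT : 0 < T) (x : Cont T m) (i : Fin m) : ℝ → ℝ :=
  fun t => x (projIcc 0 T hT.le t) i

/-- `x ∈ AC^{n-1}([0, T], ℝ^m)` (for `n ≥ 1`): on `[0, T]` the derivatives of order up to `n - 1`
of every component exist and are absolutely continuous. -/
def MemAC (n : ℕ) (hT : 0 < T) (x : Cont T m) : Prop :=
  ∀ i, ContDiffOn ℝ ((n - 1 : ℕ) : WithTop ℕ∞) (comp hT x i) (Icc 0 T) ∧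
    ∀ k < n, AbsolutelyContinuousOnInterval
      (iteratedDerivWithin k (comp hT x i) (Icc 0 T)) 0 T

/-- `x` is a solution of the periodic problem (for `n ≥ 1`): `x ∈ AC^{n-1}([0, T], ℝ^m)`,
`x^{(n)}(t) = (F x)(t)` for almost all `t ∈ [0, T]`, and
`x^{(k)}(0) = x^{(k)}(T)` for `k = 0, …, n - 1`. -/
structure IsPeriodicSolution (n : ℕ) (hT : 0 < T) (F : Cont T m → LOne T m) (x : Cont T m) :
    Prop where
  memAC : MemAC n hT x
  equation : ∀ i, ∀ᵐ t ∂(leb T), HasDerivWithinAt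
    (iteratedDerivWithin (n - 1) (comp hT x i) (Icc 0 T))
    ((F x : ℝ → Fin m → ℝ) t i) (Icc 0 T) t
  periodic : ∀ i, ∀ k < n, iteratedDerivWithin k (comp hT x i) (Icc 0 T) 0 =
    iteratedDerivWithin k (comp hT x i) (Icc 0 T) T

/-- The norm of `L_1([0, T], ℝ)`. -/
def normLOne (T : ℝ) (q : ℝ → ℝ) : ℝ := ∫ t, |q t| ∂(leb T)

end PeriodicFDE

end

/-! Fix a component with the largest oscillation `M`, and let `y` be its derivative of order `n -
1`. The condition on `F` gives reals `a`, `b` with `b - a ≤ M` and `a p ≤ y' ≤ b p` almost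
everywhere. Two points of the circle of length `T` between which `y` differs by `ω ≥ 0` cut it into
two arcs, of `p`-mass `A` and `B`: `y` rises by `ω` on one and falls by `ω` on the other, so `ω ≤ b
A` and `ω ≤ -a B`. Since `(1/A + 1/B)(A + B) ≥ 4`, this yields `4 ω ≤ M ‖p‖`
(`four_mul_sub_le_mul_normLOne`). For `n = 1` one may take `ω = M`.

For `n ≥ 2` the strict Bohr-Favard inequality `M < K T^(n-1) ω` (`sub_lt_favard_mul_pow`) closes the
loop. In period one, `r! (G(t₁) - G(t₂))` is up to sign the integral of `B_r - β` against the `r`-th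
derivative of `G(t₁ + ·) - G(t₂ + ·)`, which is at most `ω` in absolute value. For a suitable
constant `β` the `L¹` norm of `B_r - β` is `r! K_r`. Equality would force a continuous function to
jump from one of `±ω` to the other where `B_r - β` changes sign. -/

noncomputable section

namespace PeriodicFDE

/-! ### Euler numbers as values of Bernoulli polynomials at quarters. -/

section EulerNumbers

open PowerSeries

/-- Since `e^t - 1 = (e^(3t/4) - e^(t/4)) (e^(t/4) + e^(-t/4))`, the difference of the Bernoulli
generating functions at 3/4 and 1/4 is `t / (e^(t/4) + e^(-t/4))`, that is, `t/2` times the Euler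
series at `t/4`. -/
theorem two_mul_bernoulli_eval_sub (k : ℕ) :
    2 * ((Polynomial.bernoulli (k + 1)).eval (3 / 4) - (Polynomial.bernoulli (k + 1)).eval (1 / 4))
      = (k + 1) * eulerNumber k / 4 ^ k := by
  set e : ℚ → PowerSeries ℚ := fun q => rescale q (exp ℚ) with he
  set P : ℚ → PowerSeries ℚ := fun x => mk fun n =>
    Polynomial.aeval x ((1 / (n.factorial : ℚ)) • Polynomial.bernoulli n) with hP
  have gen : ∀ x, P x * (exp ℚ - 1) = X * e x := fun x =>
    Polynomial.bernoulli_generating_function x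
  have eadd : ∀ a b, e a * e b = e (a + b) := fun a b => exp_mul_exp_eq_exp_add a b
  have e0 : e 0 = 1 := by simp [he]
  have e1 : e 1 = exp ℚ := by simp [he]
  set D := e (3 / 4) - e (1 / 4) with hD
  have hD0 : D ≠ 0 := by
    intro h
    have := congrArg (coeff 1) h
    norm_num [hD, he, coeff_rescale, coeff_exp] at this
  have hfac : exp ℚ - 1 = D * (e (1 / 4) + e (-1 / 4)) := by
    rw [hD, sub_mul, mul_add, mul_add, eadd, eadd, eadd, eadd, ← e0, ← e1]
    norm_num
    ring
  have key : (P (3 / 4) - P (1 / 4)) * (e (1 / 4) + e (-1 / 4)) = X := by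
    refine mul_left_cancel₀ hD0 ?_
    have : (P (3 / 4) - P (1 / 4)) * (exp ℚ - 1) = X * D := by
      rw [sub_mul, gen, gen, hD, mul_sub]
    rw [hfac] at this
    linear_combination this
  set S := exp ℚ + evalNegHom (exp ℚ) with hS
  have hS0 : constantCoeff S ≠ 0 := by
    rw [hS, evalNegHom, map_add, ← coeff_zero_eq_constantCoeff_apply,
      ← coeff_zero_eq_constantCoeff_apply, coeff_rescale]
    norm_num [coeff_exp]
  have hE : (2 * S⁻¹) * S = 2 := by
    rw [mul_assoc, PowerSeries.inv_mul_cancel _ hS0, mul_one]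
  have hres : rescale (1 / 4) (2 * S⁻¹) * (e (1 / 4) + e (-1 / 4)) = 2 := by
    have := congrArg (rescale (1 / 4 : ℚ)) hE
    rw [map_mul, hS, map_add, evalNegHom, rescale_rescale] at this
    rw [show (-1 / 4 : ℚ) = -1 * (1 / 4) by norm_num]
    exact this.trans (map_ofNat _ 2)
  have hne : e (1 / 4) + e (-1 / 4) ≠ 0 := by
    intro h
    rw [h, mul_zero] at key
    exact X_ne_zero key.symm
  have main : 2 * (P (3 / 4) - P (1 / 4)) = X * rescale (1 / 4) (2 * S⁻¹) := by
    refine mul_right_cancel₀ hne ?_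
    linear_combination 2 * key - X * hres
  have hc := congrArg (coeff (k + 1)) main
  rw [coeff_succ_X_mul, coeff_rescale, two_mul, map_add, map_sub] at hc
  simp only [hP, coeff_mk, map_smul, smul_eq_mul, Polynomial.coe_aeval_eq_eval] at hc
  have hfact : ((k + 1).factorial : ℚ) ≠ 0 := by positivity
  rw [eulerNumber]
  rw [Nat.factorial_succ] at hc
  have : (k.factorial : ℚ) ≠ 0 := by positivity
  have h4 : (k + 1 : ℚ) ≠ 0 := by positivity
  push_cast at hc
  rw [one_div_pow] at hc
  field_simp at hc ⊢
  linear_combination hc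

end EulerNumbers

theorem bernoulliFun_ratCast (k : ℕ) (q : ℚ) :
    bernoulliFun k q = ((Polynomial.bernoulli k).eval q : ℚ) := by
  rw [bernoulliFun, Polynomial.eval_map, ← eq_ratCast (algebraMap ℚ ℝ), Polynomial.eval₂_at_apply,
    eq_ratCast]

theorem bernoulliFun_quarter {k : ℕ} (hk : Even k) :
    bernoulliFun (k + 1) (1 / 4) = -((k + 1) * eulerNumber k / 4 ^ (k + 1)) := by
  have h := congrArg (fun q : ℚ => (q : ℝ)) (two_mul_bernoulli_eval_sub k)
  push_cast [← bernoulliFun_ratCast] at h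
  have h2 := bernoulliFun_eval_one_sub (k := k + 1) (x := 1 / 4)
  rw [hk.add_one.neg_one_pow] at h2
  norm_num at h2 h ⊢
  rw [h2] at h
  rw [pow_succ]
  linear_combination -(1 / 4 : ℝ) * h

/-! ### Signs and `L¹` norms of Bernoulli polynomials. -/

theorem bernoulliFun_odd_zero (j : ℕ) : bernoulliFun (2 * j + 3) 0 = 0 := by
  rw [bernoulliFun_eval_zero, bernoulli_eq_zero_of_odd ⟨j + 1, by ring⟩ (by lia), Rat.cast_zero]

/-- Induction in steps of two: `B_{2j+3}''` is a positive multiple of `B_{2j+1}`, so the next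
function, with its sign flipped, is strictly concave; it vanishes at 0 and 1/2, hence is positive
between. -/
theorem neg_one_pow_mul_bernoulliFun_odd_pos (j : ℕ) :
    ∀ x ∈ Ioo (0 : ℝ) (1 / 2), 0 < (-1) ^ (j + 1) * bernoulliFun (2 * j + 1) x := by
  induction j with
  | zero =>
    intro x hx
    simp only [mul_zero, zero_add, bernoulliFun_one]
    linarith [hx.2]
  | succ j ih =>
    set f : ℝ → ℝ := fun x => (-1) ^ (j + 2) * bernoulliFun (2 * j + 3) x with hf
    have hd1 : deriv f = fun x => (-1) ^ (j + 2) * ((2 * j + 3 : ℕ) * bernoulliFun (2 * j + 2) x) :=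
      funext fun x => ((hasDerivAt_bernoulliFun (2 * j + 3) x).const_mul _).deriv
    have hd2 : deriv^[2] f = fun x => (-1) ^ (j + 2) * ((2 * j + 3 : ℕ) *
        ((2 * j + 2 : ℕ) * bernoulliFun (2 * j + 1) x)) := by
      rw [Function.iterate_succ, Function.iterate_one, Function.comp_apply, hd1]
      exact funext fun x =>
        (((hasDerivAt_bernoulliFun (2 * j + 2) x).const_mul _).const_mul _).deriv
    have hconc : StrictConcaveOn ℝ (Icc (0 : ℝ) (1 / 2)) f := by
      refine strictConcaveOn_of_deriv2_neg (convex_Icc _ _) (by fun_prop) fun x hx => ?_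
      rw [interior_Icc] at hx
      have h1 := ih x hx
      rw [hd2]
      have h2 : (0 : ℝ) < (2 * j + 3 : ℕ) * (2 * j + 2 : ℕ) := by positivity
      have h3 := mul_pos h2 h1
      have h4 : (-1 : ℝ) ^ (j + 2) = -(-1) ^ (j + 1) := by ring
      simp only [h4]
      linarith
    have hf0 : f 0 = 0 := by simp [hf, bernoulliFun_odd_zero]
    have hf1 : f (1 / 2) = 0 := by
      have := bernoulliFun_eval_half_eq_zero (j + 1)
      rw [show 2 * (j + 1) + 1 = 2 * j + 3 by ring, ← one_div] at this
      simp only [hf, this, mul_zero]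
    intro x hx
    have h1 := And.right hconc (show (0 : ℝ) ∈ Icc (0 : ℝ) (1 / 2) by norm_num)
      (show (1 / 2 : ℝ) ∈ Icc (0 : ℝ) (1 / 2) by norm_num) (by norm_num)
      (show 0 < 1 - 2 * x by linarith [hx.2]) (show 0 < 2 * x by linarith [hx.1]) (by ring)
    rw [hf0, hf1] at h1
    simp only [smul_eq_mul, mul_zero, add_zero, zero_add] at h1
    rw [show 2 * x * (1 / 2) = x by ring] at h1
    exact h1

theorem strictMonoOn_bernoulliFun_even (j : ℕ) :
    StrictMonoOn (fun x => (-1) ^ (j + 1) * bernoulliFun (2 * j + 2) x) (Icc (0 : ℝ) (1 / 2)) := by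
  refine strictMonoOn_of_deriv_pos (convex_Icc _ _) (by fun_prop) fun x hx => ?_
  rw [interior_Icc] at hx
  rw [((hasDerivAt_bernoulliFun (2 * j + 2) x).const_mul _).deriv]
  have h1 := neg_one_pow_mul_bernoulliFun_odd_pos j x hx
  have h2 : (0 : ℝ) < (2 * j + 2 : ℕ) := by positivity
  have h3 := mul_pos h2 h1
  rw [show 2 * j + 2 - 1 = 2 * j + 1 by lia]
  linarith

theorem integral_abs_of_sign {f : ℝ → ℝ} {a b c : ℝ} (hab : a ≤ b) (hc : |c| = 1)
    (h : ∀ x ∈ Ioo a b, 0 < c * f x) :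
    ∫ x in a..b, |f x| = c * ∫ x in a..b, f x := by
  rw [← intervalIntegral.integral_const_mul]
  refine intervalIntegral.integral_congr_Ioo_of_le hab fun x hx => ?_
  have := abs_of_pos (h x hx)
  rw [abs_mul, hc, one_mul] at this
  exact this

theorem integral_bernoulliFun_eq (k : ℕ) (a b : ℝ) :
    ∫ x in a..b, bernoulliFun k x = (bernoulliFun (k + 1) b - bernoulliFun (k + 1) a) / (k + 1) := by
  rw [intervalIntegral.integral_eq_sub_of_hasDerivAt (fun x _ => antideriv_bernoulliFun k x)
      (intervalIntegrable_bernoulliFun k _ _), sub_div]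

theorem favard_odd (j : ℕ) : ((2 * j + 1).factorial : ℝ) * favard (2 * j + 1) =
    2 * |bernoulliFun (2 * j + 2) (1 / 2) - bernoulliFun (2 * j + 2) 0| / (2 * j + 2 : ℕ) := by
  rw [favard, if_pos ⟨j, rfl⟩, one_div, bernoulliFun_eval_half, bernoulliFun_eval_zero]
  have h1 : (2 / 2 ^ (2 * j + 2) - 1) * (bernoulli (2 * j + 2) : ℝ) - bernoulli (2 * j + 2) =
      -((2 ^ (2 * j + 2) - 1) / 2 ^ (2 * j + 1) * bernoulli (2 * j + 2)) := by
    field_simp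
    ring
  have h2 : (0 : ℝ) ≤ (2 ^ (2 * j + 2) - 1) / 2 ^ (2 * j + 1) :=
    div_nonneg (sub_nonneg.2 (one_le_pow₀ (by norm_num))) (by positivity)
  rw [h1, abs_neg, abs_mul, abs_of_nonneg h2]
  have h3 : ((2 * j + 1).factorial : ℝ) ≠ 0 := by positivity
  rw [Nat.factorial_succ (2 * j + 1)]
  push_cast
  rw [show 2 * j + 1 + 1 = 2 * j + 2 by ring]
  field_simp
  ring

theorem favard_even (j : ℕ) : ((2 * j + 2).factorial : ℝ) * favard (2 * j + 2) =
    4 * |bernoulliFun (2 * j + 3) (1 / 4)| / (2 * j + 3 : ℕ) := by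
  have he : Even (2 * j + 2) := ⟨j + 1, by ring⟩
  rw [favard, if_neg (Nat.not_odd_iff_even.2 he), bernoulliFun_quarter he, abs_neg, abs_div,
    abs_mul]
  have h3 : ((2 * j + 2).factorial : ℝ) ≠ 0 := by positivity
  rw [abs_of_pos (by positivity : (0 : ℝ) < (2 * j + 2 : ℕ) + 1),
    abs_of_pos (by positivity : (0 : ℝ) < 4 ^ (2 * j + 2 + 1))]
  push_cast
  field_simp
  ring

/-- The function `f` changes sign at `s`, from that of `-c` to that of `c`. -/
def ChangesSignAt (f : ℝ → ℝ) (c s : ℝ) : Prop :=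
  ∃ δ > 0, (∀ t ∈ Ioo (s - δ) s, c * f t < 0) ∧ ∀ t ∈ Ioo s (s + δ), 0 < c * f t

theorem neg_one_pow_mul_bernoulliFun_odd_neg (j : ℕ) :
    ∀ x ∈ Ioo (1 / 2 : ℝ) 1, 0 < -(-1) ^ (j + 1) * bernoulliFun (2 * j + 1) x := by
  intro x hx
  have h := neg_one_pow_mul_bernoulliFun_odd_pos j (1 - x) ⟨by linarith [hx.2], by linarith [hx.1]⟩
  rw [bernoulliFun_eval_one_sub, Odd.neg_one_pow ⟨j, rfl⟩] at h
  linarith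

theorem abs_neg_one_pow_real (j : ℕ) : |(-1 : ℝ) ^ j| = 1 := by simp

theorem integral_abs_bernoulliFun_odd (j : ℕ) :
    ∫ x in (0 : ℝ)..1, |bernoulliFun (2 * j + 1) x| =
      ((2 * j + 1).factorial : ℝ) * favard (2 * j + 1) := by
  have hint : ∀ a b : ℝ, IntervalIntegrable (fun x => |bernoulliFun (2 * j + 1) x|) volume a b :=
    fun a b => Continuous.intervalIntegrable (by fun_prop) _ _
  have hc := abs_neg_one_pow_real (j + 1)
  have h1 := integral_abs_of_sign (by norm_num) hc (neg_one_pow_mul_bernoulliFun_odd_pos j)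
  have h2 := integral_abs_of_sign (by norm_num) (by rw [abs_neg, hc])
    (neg_one_pow_mul_bernoulliFun_odd_neg j)
  have hnn : 0 ≤ ∫ x in (0 : ℝ)..(1 / 2), |bernoulliFun (2 * j + 1) x| :=
    intervalIntegral.integral_nonneg (by norm_num) fun _ _ => abs_nonneg _
  have h0 : bernoulliFun (2 * j + 2) 1 = bernoulliFun (2 * j + 2) 0 :=
    bernoulliFun_endpoints_eq_of_ne_one (by lia)
  rw [← intervalIntegral.integral_add_adjacent_intervals (hint 0 (1 / 2)) (hint (1 / 2) 1), h2]
  rw [h1] at hnn ⊢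
  have h3 := abs_of_nonneg hnn
  rw [abs_mul, hc, one_mul] at h3
  rw [favard_odd, mul_div_assoc, ← abs_of_pos (by positivity : (0 : ℝ) < (2 * j + 2 : ℕ)),
    ← abs_div]
  rw [integral_bernoulliFun_eq] at h3 ⊢
  rw [integral_bernoulliFun_eq, h0]
  push_cast at h3 ⊢
  rw [show (2 * j + 2 : ℝ) = 2 * j + 1 + 1 by ring, h3]
  ring

/-- Follows from monotonicity on `[0, 1/2]` and the symmetry `x ↦ 1 - x`. Subtracting the value at
1/4 makes the two sign sets equally long, so this constant drops out of the `L¹` norm. -/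
theorem sign_bernoulliFun_even (j : ℕ) :
    (∀ x ∈ Ioo (0 : ℝ) (1 / 4), 0 < -(-1) ^ (j + 1) *
      (bernoulliFun (2 * j + 2) x - bernoulliFun (2 * j + 2) (1 / 4))) ∧
    (∀ x ∈ Ioo (1 / 4 : ℝ) (3 / 4), 0 < (-1) ^ (j + 1) *
      (bernoulliFun (2 * j + 2) x - bernoulliFun (2 * j + 2) (1 / 4))) ∧
    (∀ x ∈ Ioo (3 / 4 : ℝ) 1, 0 < -(-1) ^ (j + 1) *
      (bernoulliFun (2 * j + 2) x - bernoulliFun (2 * j + 2) (1 / 4))) := by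
  have hm := strictMonoOn_bernoulliFun_even j
  have hs : ∀ x, bernoulliFun (2 * j + 2) (1 - x) = bernoulliFun (2 * j + 2) x := fun x => by
    rw [bernoulliFun_eval_one_sub, Even.neg_one_pow ⟨j + 1, by ring⟩, one_mul]
  have h1 : ∀ x ∈ Ioo (0 : ℝ) (1 / 4), 0 < -(-1) ^ (j + 1) *
      (bernoulliFun (2 * j + 2) x - bernoulliFun (2 * j + 2) (1 / 4)) := fun x hx => by
    have := hm (a := x) ⟨hx.1.le, by linarith [hx.2]⟩ (b := 1 / 4) (by norm_num) hx.2
    simp only at this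
    linarith
  have h2 : ∀ x ∈ Ioc (1 / 4 : ℝ) (1 / 2), 0 < (-1) ^ (j + 1) *
      (bernoulliFun (2 * j + 2) x - bernoulliFun (2 * j + 2) (1 / 4)) := fun x hx => by
    have := hm (a := 1 / 4) (by norm_num) (b := x) ⟨by linarith [hx.1], hx.2⟩ hx.1
    simp only at this
    linarith
  refine ⟨h1, fun x hx => ?_, fun x hx => ?_⟩
  · rcases le_total x (1 / 2) with h | h
    · exact h2 x ⟨hx.1, h⟩
    · rw [← hs x]
      exact h2 (1 - x) ⟨by linarith [hx.2], by linarith⟩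
  · rw [← hs x]
    exact h1 (1 - x) ⟨by linarith [hx.2], by linarith [hx.1]⟩

theorem integral_abs_bernoulliFun_even (j : ℕ) :
    ∫ x in (0 : ℝ)..1, |bernoulliFun (2 * j + 2) x - bernoulliFun (2 * j + 2) (1 / 4)| =
      ((2 * j + 2).factorial : ℝ) * favard (2 * j + 2) := by
  obtain ⟨s1, s2, s3⟩ := sign_bernoulliFun_even j
  set β := bernoulliFun (2 * j + 2) (1 / 4)
  set f : ℝ → ℝ := fun x => bernoulliFun (2 * j + 2) x - β
  have hfc : Continuous f := by fun_prop
  have hint : ∀ a b : ℝ, IntervalIntegrable (fun x => |f x|) volume a b :=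
    fun a b => hfc.abs.intervalIntegrable _ _
  have hc := abs_neg_one_pow_real (j + 1)
  have hc' : |-(-1 : ℝ) ^ (j + 1)| = 1 := by rw [abs_neg, hc]
  have h1 := integral_abs_of_sign (f := f) (by norm_num) hc' s1
  have h2 := integral_abs_of_sign (f := f) (by norm_num) hc s2
  have h3 := integral_abs_of_sign (f := f) (by norm_num) hc' s3
  have hnn : 0 ≤ ∫ x in (0 : ℝ)..1, |f x| :=
    intervalIntegral.integral_nonneg (by norm_num) fun _ _ => abs_nonneg _
  have hf : ∀ a b : ℝ, ∫ x in a..b, f x = (bernoulliFun (2 * j + 3) b -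
      bernoulliFun (2 * j + 3) a) / (2 * j + 3) - (b - a) * β := fun a b => by
    rw [intervalIntegral.integral_sub (intervalIntegrable_bernoulliFun _ _ _)
      (by simp), integral_bernoulliFun_eq, intervalIntegral.integral_const, smul_eq_mul]
    push_cast
    ring
  have e0 := bernoulliFun_odd_zero j
  have e1 : bernoulliFun (2 * j + 3) 1 = 0 := by
    rw [bernoulliFun_endpoints_eq_of_ne_one (by lia), e0]
  have e3 : bernoulliFun (2 * j + 3) (3 / 4) = -bernoulliFun (2 * j + 3) (1 / 4) := by
    have := bernoulliFun_eval_one_sub (k := 2 * j + 3) (x := 1 / 4)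
    rw [Odd.neg_one_pow ⟨j + 1, by ring⟩] at this
    norm_num at this ⊢
    exact this
  have key : ∫ x in (0 : ℝ)..1, |f x| =
      -(4 * ((-1) ^ (j + 1) * (bernoulliFun (2 * j + 3) (1 / 4) / (2 * j + 3)))) := by
    rw [← intervalIntegral.integral_add_adjacent_intervals (hint 0 (3 / 4)) (hint (3 / 4) 1),
      ← intervalIntegral.integral_add_adjacent_intervals (hint 0 (1 / 4)) (hint (1 / 4) (3 / 4)),
      h1, h2, h3, hf, hf, hf, e0, e1, e3]
    ring
  rw [← abs_of_nonneg hnn, key, abs_neg, abs_mul, abs_mul, hc, one_mul, abs_div, favard_even,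
    abs_of_pos (by positivity : (0 : ℝ) < 2 * j + 3)]
  push_cast
  rw [abs_of_pos (by norm_num : (0 : ℝ) < 4), mul_div_assoc]

/-- Takes `β = 0` for odd `r` and `β = B_r(1/4)` for even `r`. A single interior sign change is
recorded; it is what makes the later inequality strict. -/
theorem exists_integral_abs_bernoulliFun_sub {r : ℕ} (hr : 1 ≤ r) :
    ∃ β c s : ℝ, s ∈ Ioo (0 : ℝ) 1 ∧ ChangesSignAt (fun t => bernoulliFun r t - β) c s ∧
      ∫ t in (0 : ℝ)..1, |bernoulliFun r t - β| = (r.factorial : ℝ) * favard r := by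
  rcases Nat.even_or_odd r with ⟨j, hj⟩ | ⟨j, rfl⟩
  · obtain ⟨j, rfl⟩ : ∃ i, r = 2 * i + 2 := ⟨j - 1, by lia⟩
    obtain ⟨s1, s2, -⟩ := sign_bernoulliFun_even j
    refine ⟨bernoulliFun (2 * j + 2) (1 / 4), (-1) ^ (j + 1), 1 / 4, by norm_num,
      ⟨1 / 4, by norm_num, fun t ht => ?_, fun t ht => ?_⟩, integral_abs_bernoulliFun_even j⟩
    · linarith [s1 t ⟨by linarith [ht.1], ht.2⟩]
    · exact s2 t ⟨ht.1, by linarith [ht.2]⟩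
  · refine ⟨0, -(-1) ^ (j + 1), 1 / 2, by norm_num,
      ⟨1 / 2, by norm_num, fun t ht => ?_, fun t ht => ?_⟩, ?_⟩
    · linarith [neg_one_pow_mul_bernoulliFun_odd_pos j t ⟨by linarith [ht.1], ht.2⟩]
    · linarith [neg_one_pow_mul_bernoulliFun_odd_neg j t ⟨ht.1, by linarith [ht.2]⟩]
    · simpa using integral_abs_bernoulliFun_odd j

/-! ### The strict Bohr-Favard inequality in period one. -/

open Filter Topology in
theorem integral_mul_lt_of_changesSignAt {f v : ℝ → ℝ} {c s ω : ℝ} (hf : Continuous f)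
    (hv : Continuous v) (hω : 0 < ω) (hvω : ∀ t, |v t| ≤ ω) (hs : s ∈ Ioo (0 : ℝ) 1)
    (hfs : ChangesSignAt f c s) :
    ∫ t in (0 : ℝ)..1, f t * v t < ω * ∫ t in (0 : ℝ)..1, |f t| := by
  have hle : ∀ t, f t * v t ≤ ω * |f t| := fun t => by
    calc f t * v t ≤ |f t * v t| := le_abs_self _
      _ = |v t| * |f t| := by rw [abs_mul, mul_comm]
      _ ≤ ω * |f t| := mul_le_mul_of_nonneg_right (hvω t) (abs_nonneg _)
  rw [← intervalIntegral.integral_const_mul]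
  refine intervalIntegral.integral_lt_integral_of_continuousOn_of_le_of_exists_lt one_pos
    (hf.mul hv).continuousOn (continuous_const.mul hf.abs).continuousOn (fun t _ => hle t) ?_
  -- Equality throughout would give `v = ω sgn f` wherever `f ≠ 0`, so `c * v` has one-sided limits
  -- `-ω|c|` and `ω|c|` at `s`, against continuity.
  by_contra! hcon
  have heq : ∀ t ∈ Icc (0 : ℝ) 1, f t * v t = ω * |f t| := fun t ht =>
    le_antisymm (hle t) (hcon t ht)
  obtain ⟨δ, hδ, hneg, hpos⟩ := hfs
  have hleft : ∀ᶠ t in 𝓝[<] s, c * v t = -(ω * |c|) := by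
    filter_upwards [Ioo_mem_nhdsLT (show s - δ < s by linarith), Ioo_mem_nhdsLT hs.1] with t h1 h2
    have hn := hneg t h1
    have h := heq t ⟨h2.1.le, h2.2.le.trans hs.2.le⟩
    have hf0 : f t ≠ 0 := fun h => by simp [h] at hn
    refine mul_left_cancel₀ hf0 ?_
    calc f t * (c * v t) = c * (f t * v t) := by ring
      _ = f t * -(ω * |c|) := by
        rw [h]
        rcases abs_cases (f t) with ⟨h1, h2⟩ | ⟨h1, h2⟩ <;>
        rcases abs_cases c with ⟨h3, h4⟩ | ⟨h3, h4⟩ <;> rw [h1, h3] at * <;> nlinarith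
  have hright : ∀ᶠ t in 𝓝[>] s, c * v t = ω * |c| := by
    filter_upwards [Ioo_mem_nhdsGT (show s < s + δ by linarith), Ioo_mem_nhdsGT hs.2] with t h1 h2
    have hn := hpos t h1
    have h := heq t ⟨hs.1.le.trans h2.1.le, h2.2.le⟩
    have hf0 : f t ≠ 0 := fun h => by simp [h] at hn
    refine mul_left_cancel₀ hf0 ?_
    calc f t * (c * v t) = c * (f t * v t) := by ring
      _ = f t * (ω * |c|) := by
        rw [h]
        rcases abs_cases (f t) with ⟨h1, h2⟩ | ⟨h1, h2⟩ <;>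
        rcases abs_cases c with ⟨h3, h4⟩ | ⟨h3, h4⟩ <;> rw [h1, h3] at * <;> nlinarith
  have hcv : Continuous fun t => c * v t := by fun_prop
  have e1 : c * v s = -(ω * |c|) := tendsto_nhds_unique_of_eventuallyEq
    (hcv.tendsto s |>.mono_left nhdsWithin_le_nhds) tendsto_const_nhds hleft
  have e2 : c * v s = ω * |c| := tendsto_nhds_unique_of_eventuallyEq
    (hcv.tendsto s |>.mono_left nhdsWithin_le_nhds) tendsto_const_nhds hright
  have hc : c ≠ 0 := by
    rintro rfl
    have := hpos (s + δ / 2) ⟨by linarith, by linarith⟩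
    simp at this
  have : 0 < ω * |c| := mul_pos hω (abs_pos.2 hc)
  linarith

/-- Repeated integration by parts. Boundary terms cancel by periodicity until `B_1`, whose jump of 1
between the endpoints leaves `u 0 0`. -/
theorem integral_bernoulliFun_mul {u : ℕ → ℝ → ℝ} (r : ℕ)
    (hd : ∀ k ≤ r, ∀ s, HasDerivAt (u k) (u (k + 1) s) s) (hper : ∀ k ≤ r, u k 1 = u k 0)
    (hc : Continuous (u (r + 1))) :
    ∫ s in (0 : ℝ)..1, bernoulliFun (r + 1) s * u (r + 1) s =
      (-1) ^ r * ((r + 1).factorial : ℝ) * (u 0 0 - ∫ s in (0 : ℝ)..1, u 0 s) := by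
  induction r with
  | zero =>
    rw [intervalIntegral.integral_mul_deriv_eq_deriv_mul
      (fun x _ => hasDerivAt_bernoulliFun _ x) (fun x _ => hd 0 le_rfl x)
      (Continuous.intervalIntegrable (by fun_prop) _ _) (hc.intervalIntegrable _ _)]
    simp [hper 0 le_rfl]
    ring
  | succ r ih =>
    have hcr : Continuous (u (r + 1)) :=
      continuous_iff_continuousAt.2 fun s => (hd (r + 1) le_rfl s).continuousAt
    rw [intervalIntegral.integral_mul_deriv_eq_deriv_mul
      (fun x _ => hasDerivAt_bernoulliFun _ x) (fun x _ => hd (r + 1) le_rfl x)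
      (Continuous.intervalIntegrable (by fun_prop) _ _) (hc.intervalIntegrable _ _),
      bernoulliFun_endpoints_eq_of_ne_one (by lia), hper _ le_rfl, sub_self, zero_sub,
      Nat.add_sub_cancel]
    simp only [mul_assoc]
    rw [intervalIntegral.integral_const_mul,
      ih (fun k hk => hd k (by lia)) (fun k hk => hper k (by lia)) hcr,
      Nat.factorial_succ (r + 1)]
    push_cast
    ring

/-- The strict Bohr-Favard inequality for oscillations of functions of period one. -/
theorem sub_lt_favard_mul {G : ℕ → ℝ → ℝ} {r : ℕ} (hr : 1 ≤ r)
    (hd : ∀ k < r, ∀ s, HasDerivAt (G k) (G (k + 1) s) s)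
    (hper : ∀ k < r, Function.Periodic (G k) 1) (hc : Continuous (G r)) {ω : ℝ} (hω : 0 < ω)
    (hosc : ∀ a b, G r a - G r b ≤ ω) (t₁ t₂ : ℝ) : G 0 t₁ - G 0 t₂ < favard r * ω := by
  obtain ⟨β, c, s, hs, hsign, hint⟩ := exists_integral_abs_bernoulliFun_sub hr
  obtain ⟨q, rfl⟩ : ∃ q, r = q + 1 := ⟨r - 1, by lia⟩
  -- The difference of two translates has mean zero, takes the wanted value at 0, and turns the
  -- oscillation bound on `G r` into a sup-norm bound.
  set v : ℕ → ℝ → ℝ := fun k s => G k (t₁ + s) - G k (t₂ + s) with hv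
  have hvd : ∀ k ≤ q, ∀ s, HasDerivAt (v k) (v (k + 1) s) s := fun k hk s =>
    ((hd k (by lia) _).comp_const_add t₁ s).sub ((hd k (by lia) _).comp_const_add t₂ s)
  have hvp : ∀ k ≤ q, v k 1 = v k 0 := fun k hk => by
    simp only [hv, hper k (show k < q + 1 by lia) _, add_zero]
  have hvc : Continuous (v (q + 1)) := by
    simp only [hv]
    fun_prop
  have hG0 : Continuous (G 0) :=
    continuous_iff_continuousAt.2 fun s => (hd 0 (by lia) s).continuousAt
  have hv0 : ∫ s in (0 : ℝ)..1, v 0 s = 0 := by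
    have h := fun t => (hper 0 (by lia)).intervalIntegral_add_eq t 0
    simp only [hv]
    rw [intervalIntegral.integral_sub (Continuous.intervalIntegrable (by fun_prop) _ _)
      (Continuous.intervalIntegrable (by fun_prop) _ _),
      intervalIntegral.integral_comp_add_left, intervalIntegral.integral_comp_add_left,
      add_zero, add_zero, h t₁, h t₂, sub_self]
  have hvr : ∫ s in (0 : ℝ)..1, v (q + 1) s = 0 := by
    rw [intervalIntegral.integral_eq_sub_of_hasDerivAt (fun x _ => hvd q le_rfl x)
      (hvc.intervalIntegrable _ _), hvp q le_rfl, sub_self]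
  have hker := integral_bernoulliFun_mul q hvd hvp hvc
  rw [hv0, sub_zero] at hker
  have hlt := integral_mul_lt_of_changesSignAt (f := fun t => bernoulliFun (q + 1) t - β)
    (v := fun t => (-1) ^ q * v (q + 1) t) (by fun_prop) (by fun_prop) hω
    (fun t => by
      rw [abs_mul, abs_neg_one_pow_real, one_mul, abs_le]
      constructor <;> simp only [hv] <;>
        linarith [hosc (t₁ + t) (t₂ + t), hosc (t₂ + t) (t₁ + t)]) hs hsign
  -- `β` contributes nothing because `v (q + 1)` integrates to zero over a period.
  have heq : ∫ t in (0 : ℝ)..1, (bernoulliFun (q + 1) t - β) * ((-1) ^ q * v (q + 1) t) =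
      (q + 1).factorial * v 0 0 := by
    have : ∀ t, (bernoulliFun (q + 1) t - β) * ((-1) ^ q * v (q + 1) t) =
        (-1) ^ q * (bernoulliFun (q + 1) t * v (q + 1) t) - (-1) ^ q * β * v (q + 1) t :=
      fun t => by ring
    simp only [this]
    rw [intervalIntegral.integral_sub (Continuous.intervalIntegrable (by fun_prop) _ _)
      (Continuous.intervalIntegrable (by fun_prop) _ _), intervalIntegral.integral_const_mul,
      intervalIntegral.integral_const_mul, hvr, hker, mul_zero, sub_zero, ← mul_assoc,
      ← mul_assoc, ← mul_pow]
    simp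
  rw [heq, hint] at hlt
  have hpos : (0 : ℝ) < (q + 1).factorial := by positivity
  have : v 0 0 < favard (q + 1) * ω := by
    refine lt_of_mul_lt_mul_left ?_ hpos.le
    linarith
  simpa [hv] using this

/-! ### Periodic extension and rescaling to length `T`. -/

section PeriodicExtension

variable {T : ℝ} [Fact (0 < T)]

/-- The `T`-periodic function that agrees with `f` on `[0, T)`. -/
def periodicExt (T : ℝ) [Fact (0 < T)] (f : ℝ → ℝ) (t : ℝ) : ℝ :=
  AddCircle.liftIco T 0 f (t : AddCircle T)

theorem periodicExt_periodic (f : ℝ → ℝ) : Function.Periodic (periodicExt T f) T := fun t => by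
  simp [periodicExt]

theorem periodicExt_of_mem_Ico {f : ℝ → ℝ} {t : ℝ} (ht : t ∈ Ico 0 T) :
    periodicExt T f t = f t :=
  AddCircle.liftIco_zero_coe_apply ht

theorem periodicExt_of_mem_Icc {f : ℝ → ℝ} (hf : f 0 = f T) {t : ℝ} (ht : t ∈ Icc 0 T) :
    periodicExt T f t = f t := by
  have hT : 0 < T := Fact.out
  rcases ht.2.lt_or_eq with h | rfl
  · exact periodicExt_of_mem_Ico ⟨ht.1, h⟩
  · have := periodicExt_periodic (T := t) f 0
    rw [zero_add] at this
    rw [this, periodicExt_of_mem_Ico ⟨le_rfl, hT⟩, hf]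

theorem exists_mem_Ico_add_zsmul (t : ℝ) : ∃ s ∈ Ico 0 T, ∃ z : ℤ, t = s + z • T := by
  have hT : 0 < T := Fact.out
  refine ⟨toIcoMod hT 0 t, by simpa using toIcoMod_mem_Ico hT 0 t, toIcoDiv hT 0 t, ?_⟩
  rw [toIcoMod_add_toIcoDiv_zsmul]

theorem continuous_periodicExt {f : ℝ → ℝ} (hf : f 0 = f T) (hc : ContinuousOn f (Icc 0 T)) :
    Continuous (periodicExt T f) :=
  (AddCircle.liftIco_zero_continuous hf hc).comp (AddCircle.continuous_mk' T)

theorem hasDerivAt_periodicExt {f f' : ℝ → ℝ} (hf : f 0 = f T) (hf' : f' 0 = f' T)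
    (hd : ∀ t ∈ Icc 0 T, HasDerivWithinAt f (f' t) (Icc 0 T) t) (t : ℝ) :
    HasDerivAt (periodicExt T f) (periodicExt T f' t) t := by
  have hT : 0 < T := Fact.out
  obtain ⟨s, hs, z, rfl⟩ := exists_mem_Ico_add_zsmul (T := T) t
  suffices h : HasDerivAt (periodicExt T f) (periodicExt T f' s) s by
    have h1 : HasDerivAt (fun x => periodicExt T f (x - z • T)) (periodicExt T f' s)
        (s + z • T) := by
      refine HasDerivAt.comp_sub_const (s + z • T) (z • T) ?_
      rwa [add_sub_cancel_right]
    have h2 : (fun x => periodicExt T f (x - z • T)) = periodicExt T f :=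
      funext fun x => (periodicExt_periodic f).sub_zsmul_eq z
    rw [h2] at h1
    rwa [((periodicExt_periodic (T := T) f').zsmul z) s]
  rw [periodicExt_of_mem_Ico hs]
  -- At the seam, the left derivative at 0 is the left derivative at `T` translated; `hf'` makes it
  -- agree with the right one.
  rcases hs.1.eq_or_lt with rfl | h0
  · have hr : HasDerivWithinAt (periodicExt T f) (f' 0) (Ici 0) 0 := by
      refine (((hd 0 ⟨le_rfl, hT.le⟩).congr (fun x hx => periodicExt_of_mem_Icc hf hx)
        (periodicExt_of_mem_Icc hf ⟨le_rfl, hT.le⟩)).mono_of_mem_nhdsWithin ?_)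
      exact Icc_mem_nhdsGE hT
    have hl : HasDerivWithinAt (periodicExt T f) (f' 0) (Iic 0) 0 := by
      have hl' : HasDerivWithinAt (periodicExt T f) (f' 0) (Iic T) (0 + T) := by
        rw [hf', zero_add]
        refine (((hd T ⟨hT.le, le_rfl⟩).congr (fun x hx => periodicExt_of_mem_Icc hf hx)
          (periodicExt_of_mem_Icc hf ⟨hT.le, le_rfl⟩)).mono_of_mem_nhdsWithin ?_)
        exact Icc_mem_nhdsLE hT
      have h3 := hl'.scomp (h := fun x => x + T) (h' := 1) 0
        ((hasDerivWithinAt_id 0 (Iic 0)).add_const T) (fun x hx => by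
          simpa using hx)
      rw [one_smul] at h3
      refine h3.congr (fun x _ => ?_) ?_ <;>
      exact (periodicExt_periodic f _).symm
    have := hl.union hr
    rwa [Iic_union_Ici, hasDerivWithinAt_univ] at this
  · exact ((hd s ⟨hs.1, hs.2.le⟩).hasDerivAt (Icc_mem_nhds h0 hs.2)).congr_of_eventuallyEq
      (Filter.eventuallyEq_of_mem (Icc_mem_nhds h0 hs.2)
        fun x hx => periodicExt_of_mem_Icc hf hx)

end PeriodicExtension

/-- The strict Bohr-Favard inequality for oscillations, on an interval of length `T`. -/
theorem sub_lt_favard_mul_pow {T : ℝ} (hT : 0 < T) {g : ℕ → ℝ → ℝ} {r : ℕ} (hr : 1 ≤ r)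
    (hd : ∀ k < r, ∀ t ∈ Icc 0 T, HasDerivWithinAt (g k) (g (k + 1) t) (Icc 0 T) t)
    (hper : ∀ k ≤ r, g k 0 = g k T) (hc : ContinuousOn (g r) (Icc 0 T)) {ω : ℝ} (hω : 0 < ω)
    (hosc : ∀ a ∈ Icc 0 T, ∀ b ∈ Icc 0 T, g r a - g r b ≤ ω) {t₁ t₂ : ℝ} (h₁ : t₁ ∈ Icc 0 T)
    (h₂ : t₂ ∈ Icc 0 T) : g 0 t₁ - g 0 t₂ < favard r * T ^ r * ω := by
  have : Fact (0 < T) := ⟨hT⟩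
  -- The factor `T ^ k` comes from the chain rule for `s ↦ T * s`.
  have key := sub_lt_favard_mul (G := fun k s => T ^ k * periodicExt T (g k) (T * s))
    (ω := T ^ r * ω) hr
    (fun k hk s => by
      have h1 := hasDerivAt_periodicExt (hper k hk.le) (hper (k + 1) hk) (hd k hk) (T * s)
      have h2 := (h1.comp s ((hasDerivAt_id s).const_mul T)).const_mul (T ^ k)
      refine h2.congr_deriv ?_
      ring)
    (fun k hk s => by
      simp only [mul_add, mul_one, periodicExt_periodic (g k) _])
    (continuous_const.mul ((continuous_periodicExt (hper r le_rfl) hc).comp (by fun_prop)))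
    (by positivity)
    (fun a b => by
      obtain ⟨s, hs, z, h⟩ := exists_mem_Ico_add_zsmul (T := T) (T * a)
      obtain ⟨s', hs', z', h'⟩ := exists_mem_Ico_add_zsmul (T := T) (T * b)
      rw [h, h', ((periodicExt_periodic (T := T) (g r)).zsmul z) s,
        ((periodicExt_periodic (T := T) (g r)).zsmul z') s', periodicExt_of_mem_Ico hs,
        periodicExt_of_mem_Ico hs', ← mul_sub]
      exact mul_le_mul_of_nonneg_left (hosc s ⟨hs.1, hs.2.le⟩ s' ⟨hs'.1, hs'.2.le⟩)
        (by positivity)) (t₁ / T) (t₂ / T)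
  simp only [mul_div_cancel₀ _ hT.ne', pow_zero, one_mul] at key
  rw [periodicExt_of_mem_Icc (hper 0 (by lia)) h₁,
    periodicExt_of_mem_Icc (hper 0 (by lia)) h₂] at key
  linarith

/-! ### Rise and fall of a periodic function with weighted derivative bounds. -/

theorem mul_le_of_weighted_bounds {ω a b M A B : ℝ} (hω : 0 ≤ ω) (hM0 : 0 ≤ M) (hA : 0 ≤ A)
    (hB : 0 ≤ B)
    (hM : b - a ≤ M) (h1 : ω ≤ b * A) (h2 : a * B ≤ -ω) : 4 * ω ≤ M * (A + B) := by
  rcases hω.eq_or_lt with rfl | hω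
  · rw [mul_zero]
    positivity
  · have hA' : 0 < A := lt_of_le_of_ne hA (by rintro rfl; linarith)
    have hB' : 0 < B := lt_of_le_of_ne hB (by rintro rfl; linarith)
    have h3 : ω / A ≤ b := (div_le_iff₀ hA').2 h1
    have h4 : ω / B ≤ -a := (div_le_iff₀ hB').2 (by linarith)
    have h5 : 4 * ω ≤ (ω / A + ω / B) * (A + B) := by
      have : (ω / A + ω / B) * (A + B) = 4 * ω + ω * (A - B) ^ 2 / (A * B) := by
        field_simp
        ring
      rw [this]
      have : 0 ≤ ω * (A - B) ^ 2 / (A * B) := by positivity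
      linarith
    exact h5.trans (mul_le_mul_of_nonneg_right (by linarith) (by linarith))

theorem weighted_bounds_of_absolutelyContinuous {T a b : ℝ} {h φ p : ℝ → ℝ}
    (hac : AbsolutelyContinuousOnInterval h 0 T)
    (hφ : ∀ᵐ t ∂(leb T), HasDerivWithinAt h (φ t) (Icc 0 T) t) (hp : Integrable p (leb T))
    (hlo : ∀ᵐ t ∂(leb T), a * p t ≤ φ t) (hup : ∀ᵐ t ∂(leb T), φ t ≤ b * p t)
    {u v : ℝ} (hu : 0 ≤ u) (huv : u ≤ v) (hv : v ≤ T) :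
    a * ∫ t in u..v, p t ≤ h v - h u ∧ h v - h u ≤ b * ∫ t in u..v, p t := by
  have hsub : Icc u v ⊆ Icc 0 T := Icc_subset_Icc hu hv
  have hacuv : AbsolutelyContinuousOnInterval h u v := hac.mono (by
    rw [uIcc_of_le huv, uIcc_of_le (hu.trans (huv.trans hv))]
    exact hsub)
  have hpi : IntervalIntegrable p volume u v :=
    (intervalIntegrable_iff_integrableOn_Icc_of_le huv).2 (IntegrableOn.mono_set hp hsub)
  have hmono : volume.restrict (Icc u v) ≤ leb T := Measure.restrict_mono hsub le_rfl
  -- The endpoints are discarded, since there a derivative within `[0, T]` is only one-sided.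
  have hne : ∀ c : ℝ, ∀ᵐ t ∂(leb T), t ≠ c := fun c => (Measure.ae_ne _ c)
  have hderiv : ∀ᵐ t ∂(leb T), deriv h t = φ t := by
    filter_upwards [hφ, hne 0, hne T, ae_restrict_mem measurableSet_Icc] with t h1 h2 h3 h4
    exact (h1.hasDerivAt (Icc_mem_nhds (lt_of_le_of_ne h4.1 h2.symm)
      (lt_of_le_of_ne h4.2 h3))).deriv
  rw [← hacuv.integral_deriv_eq_sub, ← intervalIntegral.integral_const_mul,
    ← intervalIntegral.integral_const_mul]
  constructor
  · refine intervalIntegral.integral_mono_ae_restrict huv (hpi.const_mul a)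
      hacuv.intervalIntegrable_deriv (ae_mono hmono ?_)
    filter_upwards [hderiv, hlo] with t h1 h2
    rwa [h1]
  · refine intervalIntegral.integral_mono_ae_restrict huv hacuv.intervalIntegrable_deriv
      (hpi.const_mul b) (ae_mono hmono ?_)
    filter_upwards [hderiv, hup] with t h1 h2
    rwa [h1]

/-- One arc is the interval between `s` and `t`; the other consists of the two outer pieces, glued
by `h 0 = h T`. The order of `s` and `t` decides which arc carries the rise. -/
theorem four_mul_sub_le_mul_normLOne {T a b M : ℝ} {h φ p : ℝ → ℝ} (hT : 0 < T)
    (hac : AbsolutelyContinuousOnInterval h 0 T) (hper : h 0 = h T)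
    (hφ : ∀ᵐ t ∂(leb T), HasDerivWithinAt h (φ t) (Icc 0 T) t) (hp : Integrable p (leb T))
    (hp_pos : ∀ᵐ t ∂(leb T), 0 < p t)
    (hlo : ∀ᵐ t ∂(leb T), a * p t ≤ φ t) (hup : ∀ᵐ t ∂(leb T), φ t ≤ b * p t)
    (hM0 : 0 ≤ M) (hM : b - a ≤ M) {s t : ℝ} (hs : s ∈ Icc 0 T) (ht : t ∈ Icc 0 T) :
    4 * (h s - h t) ≤ M * normLOne T p := by
  have hnorm : normLOne T p = ∫ t in (0 : ℝ)..T, p t := by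
    rw [normLOne, intervalIntegral.integral_of_le hT.le, ← integral_Icc_eq_integral_Ioc]
    refine integral_congr_ae ?_
    filter_upwards [hp_pos] with t h1
    exact abs_of_pos h1
  have hbd : ∀ u v : ℝ, 0 ≤ u → u ≤ v → v ≤ T → _ := fun u v =>
    weighted_bounds_of_absolutelyContinuous hac hφ hp hlo hup
  have hint : ∀ u v : ℝ, 0 ≤ u → u ≤ v → v ≤ T → IntervalIntegrable p volume u v :=
    fun u v hu huv hv => (intervalIntegrable_iff_integrableOn_Icc_of_le huv).2
      (IntegrableOn.mono_set hp (Icc_subset_Icc hu hv))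
  have hnn : ∀ u v : ℝ, 0 ≤ u → u ≤ v → v ≤ T → 0 ≤ ∫ t in u..v, p t :=
    fun u v hu huv hv => intervalIntegral.integral_nonneg_of_ae_restrict huv
      (ae_mono (Measure.restrict_mono (Icc_subset_Icc hu hv) le_rfl)
        (hp_pos.mono fun _ h => h.le))
  have hsplit : ∀ u v : ℝ, 0 ≤ u → u ≤ v → v ≤ T → normLOne T p =
      (∫ t in u..v, p t) + ((∫ t in (0 : ℝ)..u, p t) + ∫ t in v..T, p t) :=
    fun u v hu huv hv => by
      rw [hnorm, ← intervalIntegral.integral_add_adjacent_intervals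
        (hint 0 v le_rfl (hu.trans huv) hv) (hint v T (hu.trans huv) hv le_rfl),
        ← intervalIntegral.integral_add_adjacent_intervals
        (hint 0 u le_rfl hu (huv.trans hv)) (hint u v hu huv hv)]
      ring
  rcases le_total (h s - h t) 0 with hω | hω
  · have : 0 ≤ M * normLOne T p := by
      rw [hnorm]
      exact mul_nonneg hM0 (hnn 0 T le_rfl hT.le le_rfl)
    linarith
  rcases le_total t s with hts | hst
  · rw [hsplit t s ht.1 hts hs.2]
    have b1 := hbd t s ht.1 hts hs.2
    have b2 := hbd 0 t le_rfl ht.1 ht.2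
    have b3 := hbd s T hs.1 hs.2 le_rfl
    refine mul_le_of_weighted_bounds (a := a) (b := b) hω hM0 (hnn t s ht.1 hts hs.2)
      (add_nonneg (hnn 0 t le_rfl ht.1 ht.2) (hnn s T hs.1 hs.2 le_rfl)) hM b1.2 ?_
    rw [mul_add]
    linarith [b2.1, b3.1]
  · rw [hsplit s t hs.1 hst ht.2, add_comm]
    have b1 := hbd s t hs.1 hst ht.2
    have b2 := hbd 0 s le_rfl hs.1 hs.2
    have b3 := hbd t T ht.1 ht.2 le_rfl
    refine mul_le_of_weighted_bounds (a := a) (b := b) hω hM0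
      (add_nonneg (hnn 0 s le_rfl hs.1 hs.2) (hnn t T ht.1 ht.2 le_rfl))
      (hnn s t hs.1 hst ht.2) hM ?_ (by linarith [b1.1])
    rw [mul_add]
    linarith [b2.2, b3.2]

theorem exists_bounds_of_essOsc_le {T M : ℝ} (hT : 0 < T) {f : ℝ → ℝ}
    (h : essOsc T f ≤ (M : EReal)) :
    ∃ a b : ℝ, b - a ≤ M ∧ ∀ᵐ t ∂(leb T), a ≤ f t ∧ f t ≤ b := by
  have hne : NeZero (leb T) := ⟨by
    rw [Ne, Measure.restrict_eq_zero, Real.volume_Icc]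
    simpa using hT⟩
  have hup := ae_le_essSup (μ := leb T) (f := fun t => (f t : EReal))
  have hlo := ae_essInf_le (μ := leb T) (f := fun t => (f t : EReal))
  rw [essOsc] at h
  set S := essSup (fun t => (f t : EReal)) (leb T)
  set I := essInf (fun t => (f t : EReal)) (leb T)
  -- A point satisfying both bounds excludes `S = ⊥` and `I = ⊤`, so that an infinite `S` or `I`
  -- would make `S - I = ⊤`; conventions such as `⊤ - ⊤ = ⊥` cannot interfere.
  obtain ⟨t, h1, h2⟩ := (hup.and hlo).exists
  have hS : S ≠ ⊥ := ((EReal.bot_lt_coe _).trans_le h1).ne'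
  have hI : I ≠ ⊤ := (h2.trans_lt (EReal.coe_lt_top _)).ne
  have hS' : S ≠ ⊤ := fun hS' => by
    rw [hS', EReal.top_sub hI] at h
    exact EReal.coe_ne_top _ (top_le_iff.1 h)
  have hI' : I ≠ ⊥ := fun hI' => by
    rw [hI', EReal.sub_bot hS] at h
    exact EReal.coe_ne_top _ (top_le_iff.1 h)
  clear_value S I
  lift S to ℝ using ⟨hS', hS⟩
  lift I to ℝ using ⟨hI, hI'⟩
  refine ⟨I, S, by exact_mod_cast h, ?_⟩
  filter_upwards [hup, hlo] with t h1 h2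
  exact ⟨by exact_mod_cast h2, by exact_mod_cast h1⟩

/-! ### Oscillations of a solution and the two competing estimates. -/

variable {T : ℝ} {m : ℕ}

theorem continuous_component (x : Cont T m) (i : Fin m) : Continuous fun t => x t i :=
  (continuous_apply i).comp x.continuous

theorem sub_le_osc (x : Cont T m) (i : Fin m) (s t : Icc (0 : ℝ) T) : x s i - x t i ≤ osc x i := by
  have hc := isCompact_range (continuous_component x i)
  exact sub_le_sub (le_ciSup hc.bddAbove s) (ciInf_le hc.bddBelow t)

theorem exists_osc_eq (hT : 0 < T) (x : Cont T m) (i : Fin m) :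
    ∃ s t : Icc (0 : ℝ) T, osc x i = x s i - x t i := by
  have : Nonempty (Icc (0 : ℝ) T) := ⟨⟨0, le_rfl, hT.le⟩⟩
  have hc := isCompact_range (continuous_component x i)
  obtain ⟨s, hs⟩ := hc.sSup_mem (range_nonempty _)
  obtain ⟨t, ht⟩ := hc.sInf_mem (range_nonempty _)
  exact ⟨s, t, by rw [osc, iSup, iInf]; exact congrArg₂ _ hs.symm ht.symm⟩

theorem osc_pos_of_nonconst (hT : 0 < T) {x : Cont T m}
    (hx : ¬ ∃ c : Fin m → ℝ, ∀ t, x t = c) {i : Fin m} (hi : ∀ k, osc x k ≤ osc x i) :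
    0 < osc x i := by
  by_contra! hle
  refine hx ⟨x ⟨0, le_rfl, hT.le⟩, fun t => funext fun k => ?_⟩
  have h1 := sub_le_osc x k t ⟨0, le_rfl, hT.le⟩
  have h2 := sub_le_osc x k ⟨0, le_rfl, hT.le⟩ t
  have h3 := hi k
  linarith

theorem iSup_osc_eq {x : Cont T m} {i : Fin m} (hi : ∀ k, osc x k ≤ osc x i) :
    ⨆ k, osc x k = osc x i :=
  have : Nonempty (Fin m) := ⟨i⟩
  le_antisymm (ciSup_le hi) (le_ciSup (finite_range _).bddAbove i)

theorem four_mul_sub_iteratedDerivWithin_le {n : ℕ} (hn : 1 ≤ n) (hT : 0 < T)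
    {F : Cont T m → LOne T m} {p : Fin m → ℝ → ℝ} (hp_int : ∀ i, Integrable (p i) (leb T))
    (hp_pos : ∀ i, ∀ᵐ t ∂(leb T), 0 < p i t) (hF : OscCondition F p) {x : Cont T m}
    (hx : IsPeriodicSolution n hT F x) {i : Fin m} (hi : ∀ k, osc x k ≤ osc x i) {s t : ℝ}
    (hs : s ∈ Icc 0 T) (ht : t ∈ Icc 0 T) :
    4 * (iteratedDerivWithin (n - 1) (comp hT x i) (Icc 0 T) s -
      iteratedDerivWithin (n - 1) (comp hT x i) (Icc 0 T) t) ≤ osc x i * normLOne T (p i) := by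
  have h1 : essOsc T (fun t => (F x : ℝ → Fin m → ℝ) t i / p i t) ≤ (osc x i : EReal) := by
    have := hF x
    rw [iSup_osc_eq hi] at this
    exact (le_iSup (fun i => essOsc T fun t => (F x : ℝ → Fin m → ℝ) t i / p i t) i).trans this
  obtain ⟨a, b, hab, hbd⟩ := exists_bounds_of_essOsc_le hT h1
  have hnn : 0 ≤ osc x i := by simpa using sub_le_osc x i ⟨0, le_rfl, hT.le⟩ ⟨0, le_rfl, hT.le⟩
  refine four_mul_sub_le_mul_normLOne (a := a) (b := b) hT ((hx.memAC i).2 (n - 1) (by lia))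
    (hx.periodic i (n - 1) (by lia)) (hx.equation i) (hp_int i) (hp_pos i) ?_ ?_ hnn hab hs ht
  · filter_upwards [hbd, hp_pos i] with t h2 h3
    exact (le_div_iff₀ h3).1 h2.1
  · filter_upwards [hbd, hp_pos i] with t h2 h3
    exact (div_le_iff₀ h3).1 h2.2

/-- Bohr-Favard applied at points where the extrema are attained. Allowing any positive upper bound
`ω` lets the positivity of the constant and of the norm be deduced afterwards. -/
theorem osc_lt_favard_mul {n : ℕ} (hn : 2 ≤ n) (hT : 0 < T) {F : Cont T m → LOne T m}
    {x : Cont T m} (hx : IsPeriodicSolution n hT F x) (i : Fin m) {ω : ℝ} (hω : 0 < ω)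
    (hosc : ∀ s ∈ Icc 0 T, ∀ t ∈ Icc 0 T,
      iteratedDerivWithin (n - 1) (comp hT x i) (Icc 0 T) s -
        iteratedDerivWithin (n - 1) (comp hT x i) (Icc 0 T) t ≤ ω) :
    osc x i < favard (n - 1) * T ^ (n - 1) * ω := by
  obtain ⟨s, t, hst⟩ := exists_osc_eq hT x i
  have huniq := uniqueDiffOn_Icc hT
  have hcd := (hx.memAC i).1
  have key := sub_lt_favard_mul_pow hT
    (g := fun k => iteratedDerivWithin k (comp hT x i) (Icc 0 T)) (r := n - 1) (by lia)
    (fun k hk t ht => by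
      rw [iteratedDerivWithin_succ]
      exact (hcd.differentiableOn_iteratedDerivWithin (by exact_mod_cast hk) huniq t
        ht).hasDerivWithinAt)
    (fun k hk => hx.periodic i k (by lia))
    (hcd.continuousOn_iteratedDerivWithin le_rfl huniq) hω hosc s.2 t.2
  simp only [iteratedDerivWithin_zero, comp, projIcc_val] at key
  rwa [hst]

end PeriodicFDE

end

/-! ### Combining the estimates. -/

theorem theorem2 (n m : ℕ) (hn : 1 ≤ n) (T : ℝ) (hT : 0 < T)
    (F : PeriodicFDE.Cont T m → PeriodicFDE.LOne T m)
    (p : Fin m → ℝ → ℝ)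
    (hp_int : ∀ i, Integrable (p i) (PeriodicFDE.leb T))
    (hp_pos : ∀ i, ∀ᵐ t ∂(PeriodicFDE.leb T), 0 < p i t)
    (hF : PeriodicFDE.OscCondition F p)
    (x : PeriodicFDE.Cont T m)
    (hx : PeriodicFDE.IsPeriodicSolution n hT F x)
    (hx_nonconst : ¬ ∃ c : Fin m → ℝ, ∀ t, x t = c) :
    (∀ i, (∀ k, PeriodicFDE.osc x k ≤ PeriodicFDE.osc x i) →
      (n = 1 → 4 ≤ PeriodicFDE.normLOne T (p i)) ∧
      (2 ≤ n → 4 / ((PeriodicFDE.favard (n - 1) : ℝ) * T ^ (n - 1)) <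
        PeriodicFDE.normLOne T (p i))) ∧
    (n = 1 → 4 ≤ ⨆ i, PeriodicFDE.normLOne T (p i)) ∧
    (2 ≤ n → 4 / ((PeriodicFDE.favard (n - 1) : ℝ) * T ^ (n - 1)) <
      ⨆ i, PeriodicFDE.normLOne T (p i)) := by
  have main : ∀ i, (∀ k, PeriodicFDE.osc x k ≤ PeriodicFDE.osc x i) →
      (n = 1 → 4 ≤ PeriodicFDE.normLOne T (p i)) ∧
      (2 ≤ n → 4 / ((PeriodicFDE.favard (n - 1) : ℝ) * T ^ (n - 1)) <
        PeriodicFDE.normLOne T (p i)) := by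
    intro i hi
    have hpos := PeriodicFDE.osc_pos_of_nonconst hT hx_nonconst hi
    have hle : ∀ s ∈ Icc 0 T, ∀ t ∈ Icc 0 T, _ := fun s hs t ht =>
      PeriodicFDE.four_mul_sub_iteratedDerivWithin_le hn hT hp_int hp_pos hF hx hi hs ht
    refine ⟨?_, fun hn2 => ?_⟩
    · rintro rfl
      obtain ⟨s, t, hst⟩ := PeriodicFDE.exists_osc_eq hT x i
      have h := hle s s.2 t t.2
      simp only [Nat.sub_self, iteratedDerivWithin_zero, PeriodicFDE.comp, projIcc_val] at h
      rw [← hst, mul_comm] at h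
      exact le_of_mul_le_mul_left h hpos
    · set M := PeriodicFDE.osc x i
      set P := PeriodicFDE.normLOne T (p i)
      set K : ℝ := (PeriodicFDE.favard (n - 1) : ℝ) * T ^ (n - 1)
      have hP0 : 0 ≤ P := integral_nonneg fun t => abs_nonneg _
      have hlt : ∀ ω : ℝ, 0 < ω → M * P / 4 ≤ ω → M < K * ω := fun ω h0 h1 =>
        PeriodicFDE.osc_lt_favard_mul hn2 hT hx i h0 fun s hs t ht => by
          linarith [hle s hs t ht]
      -- Positivity of the Favard constant is read off from `0 < M < K * ω` for one admissible `ω`.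
      have hK : 0 < K := by
        have h := hlt (M * P / 4 + 1) (by positivity) (by linarith)
        exact pos_of_mul_pos_left (hpos.trans h) (by positivity)
      -- If `P = 0`, every positive `ω` is admissible, and `ω = M / K` gives `M < M`.
      have hP : 0 < P := by
        refine lt_of_le_of_ne hP0 fun h0 => ?_
        have h := hlt (M / K) (by positivity) (by rw [← h0]; simp; positivity)
        rw [mul_div_cancel₀ _ hK.ne'] at h
        exact lt_irrefl _ h
      have h := hlt (M * P / 4) (by positivity) le_rfl
      rw [div_lt_iff₀ hK]
      have h2 : M * 4 < M * (P * K) := by linarith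
      exact lt_of_mul_lt_mul_left h2 hpos.le
  -- For `m = 0` every `x` is constant.
  have hne : Nonempty (Fin m) := by
    by_contra hempty
    have := not_nonempty_iff.1 hempty
    exact hx_nonconst ⟨0, fun t => Subsingleton.elim _ _⟩
  obtain ⟨i, hi⟩ := Finite.exists_max (PeriodicFDE.osc x)
  have hsup : PeriodicFDE.normLOne T (p i) ≤ ⨆ i, PeriodicFDE.normLOne T (p i) :=
    le_ciSup (f := fun i => PeriodicFDE.normLOne T (p i)) (finite_range _).bddAbove i
  exact ⟨main, fun h => ((main i hi).1 h).trans hsup, fun h => ((main i hi).2 h).trans_le hsup⟩
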